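/- **Setting.** Let $n\ge 2$ and $\tau\ge 0$ be integers, and let $S_i^{(t)}, A_i^{(t)}$ be finite sets for $1\le i\le n$, $0\le t\le\tau$. A $\tau$-step latency-constrained (LC) game $(\mathcal V,\pi,\ell)$ consists of a probabilistic predicate $\mathcal V:\prod_{i,t}A_i^{(t)}\times\prod_{i,t}S_i^{(t)}\to[0,1]$, a probability distribution $\pi$ on $\prod_{i,t}S_i^{(t)}$, and a latency function $\ell:[n]\times[n]\to\{1,2,\dots\}$ with $\ell(i,i)=1$ for all $i$. A *quantum strategy* for the game consists of the following data. * For all $i,j\in[n]$ and all integers $r\ge 0$, a complex Hilbert space $B_{i\to j}^{(r)}$ (of arbitrary dimension): the system sent by party $i$ to party $j$ that arrives at time $r$, and so was sent at time $r-\ell(i,j)$. If $i\ne j$ and either $r<\ell(i,j)$ or $r>\tau$, this space is one-dimensional. The space $B_{i\to i}^{(0)}$ is the initial register of party $i$, and $B_{i\to i}^{(\tau+1)}$ is the register left with party $i$ after the last step. * A unit vector $|\psi\rangle\in\bigotimes_{i=1}^n B_{i\to i}^{(0)}$. * For each party $i$, time $t\in\{0,\dots,\tau\}$ and input $s\in S_i^{(t)}$,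 an isometry (the interaction tensor with its classical input leg fixed) $$W_i^{(t)}|s\rangle:\ \bigotimes_{j=1}^n B_{j\to i}^{(t)}\ \to\ \mathbb C^{A_i^{(t)}}\otimes\bigotimes_{j=1}^n B_{i\to j}^{(t+\ell(i,j))}.$$ For $\mathbf s=(s_i^{(t)})$ and $\mathbf a=(a_i^{(t)})$ put $$|\psi(\mathbf a|\mathbf s)\rangle=\prod_{t=0}^{\tau}\Bigl[\bigotimes_{i=1}^n\langle a_i^{(t)}|W_i^{(t)}|s_i^{(t)}\rangle\Bigr]|\psi\rangle ,$$ where the factors are applied in the order $t=0,1,\dots,\tau$ and the factor at time $t$ acts as the identity on the systems in transit at time $t$. The *behavior* realized by the strategy is $p(\mathbf a|\mathbf s)=\bigl\||\psi(\mathbf a|\mathbf s)\rangle\bigr\|^2$. Let $\mathcal Q$ be the set of the behaviors realized by all quantum strategies for the game. **Proposition.** For every $\tau$-step LC game $(\mathcal V,\pi,\ell)$, the set $\mathcal Q$, as a subset of the real functions of $(\mathbf a,\mathbf s)$, is convex. -/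

import Mathlib

universe u v w

noncomputable section

/-! ### Hilbert spaces with a chosen orthonormal basis

A Hilbert space with an orthonormal basis indexed by an arbitrary type `I` is `ℓ²(I)`.  In these
coordinates the (completed) tensor product of `ℓ²(I)` and `ℓ²(J)` is `ℓ²(I × J)`, and the tensor
product of the spaces `ℓ²(I i)` is `ℓ²(∀ i, I i)`. -/

/-- The complex Hilbert space `ℓ²(I)`; every complex Hilbert space is of this form. -/
abbrev Ell2 (I : Type*) : Type _ := lp (fun _ : I => ℂ) 2

/-- The standard basis vector of `ℓ²(I)` at the index `x`. -/
def basisVec {I : Type*} (x : I) : Ell2 I :=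
  open scoped Classical in lp.single 2 x (1 : ℂ)

theorem basisVec_orthonormal {I : Type*} : Orthonormal ℂ (basisVec (I := I)) := by
  classical
  rw [orthonormal_iff_ite]
  intro x y
  unfold basisVec
  rw [lp.inner_single_left, lp.single_apply]
  split_ifs <;> simp_all

theorem memEll2_iff {I : Type*} {f : I → ℂ} :
    Memℓp f 2 ↔ Summable fun x => ‖f x‖ ^ 2 := by
  rw [memℓp_gen_iff (by norm_num)]
  norm_num

theorem hasSum_normSq {I : Type*} (v : Ell2 I) : HasSum (fun x => ‖v x‖ ^ 2) (‖v‖ ^ 2) := by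
  have := lp.hasSum_norm (p := 2) (by norm_num) v
  norm_num at this
  exact this

/-- The vector of `ℓ²(I)` whose coordinate at `x` is the coordinate of `v` at `f x`, for an
injective `f`.  A bijective `f` relabels the basis; in general this reads off a part of the
coordinates of `v`. -/
def pullback {I J : Type*} (f : I → J) (hf : Function.Injective f) (v : Ell2 J) : Ell2 I :=
  ⟨fun x => v (f x), memEll2_iff.2 ((memEll2_iff.1 (lp.memℓp v)).comp_injective hf)⟩

theorem hasSum_prod_coord {n : ℕ} {J : Fin n → Type*} (g : ∀ i, J i → ℂ)
    (hg : ∀ i, Summable fun y => ‖g i y‖) :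
    (Summable fun y : ∀ i, J i => ‖∏ i, g i (y i)‖) ∧
      HasSum (fun y : ∀ i, J i => ∏ i, g i (y i)) (∏ i, ∑' y, g i y) := by
  induction n with
  | zero => exact ⟨(hasSum_unique _).summable, by simp⟩
  | succ n ih =>
    obtain ⟨h1, h2⟩ := ih (fun i => g i.succ) fun i => hg i.succ
    have e : (fun y : ∀ i, J i => ∏ i, g i (y i)) ∘ Fin.consEquiv J =
        fun z : J 0 × (∀ i : Fin n, J i.succ) => g 0 z.1 * ∏ i, g i.succ (z.2 i) := by
      funext z
      simp [Fin.prod_univ_succ, Fin.consEquiv]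
    have s := Summable.mul_norm (hg 0) h1
    have s' : Summable fun y : ∀ i, J i => ‖∏ i, g i (y i)‖ := by
      rw [← (Fin.consEquiv J).summable_iff]
      convert s using 2
      exact congrArg norm (congrFun e _)
    refine ⟨s', ?_⟩
    have h3 : HasSum (g 0) (∑' y, g 0 y) := (hg 0).of_norm.hasSum
    have h4 := h3.mul h2 s.of_norm
    rw [← (Fin.consEquiv J).hasSum_iff, e, Fin.prod_univ_succ]
    exact h4

/-- The product vector `f₀ ⊗ ⋯ ⊗ fₙ₋₁`. -/
def tensorVec {n : ℕ} {J : Fin n → Type*} (f : ∀ i, Ell2 (J i)) : Ell2 (∀ i, J i) :=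
  ⟨fun y => ∏ i, f i (y i), memEll2_iff.2 <| by
    have h := (hasSum_prod_coord (fun i y => ((‖f i y‖ ^ 2 : ℝ) : ℂ)) fun i => by
      simpa using (memEll2_iff.1 (lp.memℓp (f i)))).1
    refine h.congr fun y => ?_
    simp [norm_prod, Finset.prod_pow]⟩

theorem inner_tensorVec {n : ℕ} {J : Fin n → Type*} (f g : ∀ i, Ell2 (J i)) :
    inner ℂ (tensorVec f) (tensorVec g) = ∏ i, inner ℂ (f i) (g i) := by
  have h := (hasSum_prod_coord (fun i y => inner ℂ (f i y) (g i y)) fun i =>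
    (lp.summable_inner (𝕜 := ℂ) (f i) (g i)).norm).2
  refine (lp.hasSum_inner (𝕜 := ℂ) (tensorVec f) (tensorVec g)).unique ?_
  have e : (fun y : ∀ i, J i => inner ℂ (tensorVec f y) (tensorVec g y)) =
      fun y => ∏ i, inner ℂ (f i (y i)) (g i (y i)) := by
    funext y
    simp only [tensorVec, RCLike.inner_apply, map_prod, Finset.prod_mul_distrib]
  rw [e]
  exact h

theorem tensorVec_orthonormal {n : ℕ} {I J : Fin n → Type*}
    (W : ∀ i, Ell2 (I i) →ₗᵢ[ℂ] Ell2 (J i)) :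
    Orthonormal ℂ fun x : ∀ i, I i => tensorVec fun i => W i (basisVec (x i)) := by
  classical
  rw [orthonormal_iff_ite]
  intro x x'
  have h : ∀ i, inner ℂ (W i (basisVec (x i))) (W i (basisVec (x' i))) =
      if x i = x' i then (1 : ℂ) else 0 := fun i => by
    rw [LinearIsometry.inner_map_map]
    exact orthonormal_iff_ite.1 basisVec_orthonormal _ _
  rw [inner_tensorVec, Finset.prod_congr rfl fun i _ => h i, Finset.prod_ite_zero]
  simp [funext_iff]

/-- The tensor product `W₀ ⊗ ⋯ ⊗ Wₙ₋₁` of isometries: the isometry that maps the basis vector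
`e_{x₀} ⊗ ⋯ ⊗ e_{xₙ₋₁}` to `W₀ e_{x₀} ⊗ ⋯ ⊗ Wₙ₋₁ e_{xₙ₋₁}`. -/
def tensorIsometry {n : ℕ} {I J : Fin n → Type*} (W : ∀ i, Ell2 (I i) →ₗᵢ[ℂ] Ell2 (J i)) :
    Ell2 (∀ i, I i) →ₗᵢ[ℂ] Ell2 (∀ i, J i) :=
  (tensorVec_orthonormal W).orthogonalFamily.linearIsometry

/-- The slice `v (·, r)` of `v ∈ ℓ²(I × R)`. -/
def slice {I R : Type*} (v : Ell2 (I × R)) (r : R) : Ell2 I :=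
  pullback (fun x => (x, r)) (Prod.mk_left_injective r) v

theorem summable_applyLeft {I J R : Type*} (U : Ell2 I →ₗᵢ[ℂ] Ell2 J) (v : Ell2 (I × R)) :
    Summable fun z : J × R => ‖U (slice v z.2) z.1‖ ^ 2 := by
  have hv : Summable fun z : R × I => ‖v z.swap‖ ^ 2 :=
    (hasSum_normSq v).summable.prod_symm
  have hw : Summable fun r => ‖slice v r‖ ^ 2 :=
    hv.prod.congr fun r => (hasSum_normSq (slice v r)).tsum_eq
  have hU : Summable fun z : R × J => ‖U (slice v z.1) z.2‖ ^ 2 := by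
    rw [summable_prod_of_nonneg (fun z => sq_nonneg _)]
    refine ⟨fun r => (hasSum_normSq (U (slice v r))).summable, hw.congr fun r => ?_⟩
    rw [(hasSum_normSq (U (slice v r))).tsum_eq, LinearIsometry.norm_map]
  exact hU.prod_symm

/-- `U ⊗ 1 : ℓ²(I) ⊗ ℓ²(R) → ℓ²(J) ⊗ ℓ²(R)` applied to `v`: each slice `v (·, r)` is mapped
by `U`. -/
def applyLeft {I J R : Type*} (U : Ell2 I →ₗᵢ[ℂ] Ell2 J) (v : Ell2 (I × R)) : Ell2 (J × R) :=
  ⟨fun z => U (slice v z.2) z.1, memEll2_iff.2 (summable_applyLeft U v)⟩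

/-! ### Multi-step latency-constrained games -/

/-- A `τ`-step latency-constrained game `(𝒱, π, ℓ)` with `n` parties.  The time steps are
`0, …, τ`; party `i` receives an input from `S i t` and gives an output in `A i t` at step `t`. -/
structure LCGame (n τ : ℕ) (S A : Fin n → Fin (τ + 1) → Type*) where
  two_le : 2 ≤ n
  /-- the probabilistic predicate `𝒱` -/
  predicate : (∀ i t, A i t) → (∀ i t, S i t) → Set.Icc (0 : ℝ) 1
  /-- the input distribution `π` -/
  inputDist : PMF (∀ i t, S i t)
  /-- the latency function `ℓ` -/
  latency : Fin n → Fin n → ℕ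
  latency_pos : ∀ i j, 0 < latency i j
  latency_self : ∀ i, latency i i = 1

/-- A quantum strategy of a `τ`-step LC game. The Hilbert spaces of the wires are arbitrary, and
each is written in an orthonormal basis. -/
structure QuantumStrategy {n τ : ℕ} {S : Fin n → Fin (τ + 1) → Type v}
    {A : Fin n → Fin (τ + 1) → Type w} (G : LCGame n τ S A) where
  /-- `wire i j r` indexes an orthonormal basis of the quantum system sent by party `i` to party
  `j` that arrives at time `r`, hence was sent at time `r - ℓ(i, j)`.  The system
  `wire i i 0` is the initial register of party `i` (its share of the initial state), and
  `wire i i (τ + 1)` is the register that is left with party `i` after the last step. -/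
  wire : Fin n → Fin n → ℕ → Type u
  /-- Between distinct parties, the legs that would have been sent before time `0` or would
  arrive after time `τ` are one-dimensional. -/
  wire_trivial : ∀ i j r, i ≠ j → (r < G.latency i j ∨ τ < r) → Nonempty (Unique (wire i j r))
  /-- the shared initial state, a unit vector of the tensor product of the initial registers -/
  state : Ell2 (∀ i, wire i i 0)
  norm_state : ‖state‖ = 1
  /-- the interaction tensor `W_i^{(t)}`: for each classical input, an isometry from the quantum
  input legs to the classical output leg together with the quantum output legs -/
  tensor : ∀ (i : Fin n) (t : Fin (τ + 1)), S i t →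
    Ell2 (∀ j, wire j i t) →ₗᵢ[ℂ] Ell2 (A i t × ∀ j, wire i j (t + G.latency i j))

namespace QuantumStrategy

variable {n τ : ℕ} {S : Fin n → Fin (τ + 1) → Type v} {A : Fin n → Fin (τ + 1) → Type w}
  {G : LCGame n τ S A} (σ : QuantumStrategy.{u} G)

/-- Basis of the systems that exist just before step `t`: those that arrive at a time `r ≥ t` and
were sent at a time `r - ℓ(i, j) < t`. -/
abbrev InFlight (t : ℕ) : Type u := ∀ i j, ∀ r : Set.Ico t (t + G.latency i j), σ.wire i j r

/-- Basis of the systems that are in transit during step `t`, on which nobody acts. -/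
abbrev Spectators (t : ℕ) : Type u := ∀ i j, ∀ r : Set.Ioo t (t + G.latency i j), σ.wire i j r

/-- The systems just before step `t` are the legs entering the interaction tensors of that step and
the systems in transit. -/
def incoming (t : ℕ) (z : (∀ j, ∀ i, σ.wire i j t) × σ.Spectators t) : σ.InFlight t :=
  fun i j r => if h : t = r.1 then h ▸ z.1 j i else
    z.2 i j ⟨r.1, lt_of_le_of_ne r.2.1 h, r.2.2⟩

theorem incoming_bijective (t : ℕ) : Function.Bijective (σ.incoming t) := by
  constructor
  · rintro ⟨x, y⟩ ⟨x', y'⟩ h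
    refine Prod.ext ?_ ?_
    · funext j i
      have := congrFun (congrFun (congrFun h i) j)
        ⟨t, le_refl t, Nat.lt_add_of_pos_right (G.latency_pos i j)⟩
      simpa [incoming] using this
    · funext i j r
      have := congrFun (congrFun (congrFun h i) j) ⟨r.1, r.2.1.le, r.2.2⟩
      have hne : t ≠ r.1 := r.2.1.ne
      simpa [incoming, hne] using this
  · intro z
    refine ⟨⟨fun j i => z i j ⟨t, le_refl t, Nat.lt_add_of_pos_right (G.latency_pos i j)⟩,
      fun i j r => z i j ⟨r.1, r.2.1.le, r.2.2⟩⟩, ?_⟩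
    funext i j ⟨r, hr⟩
    by_cases h : t = r
    · subst h
      simp [incoming]
    · simp [incoming, h]

/-- The systems just after step `t` are the legs leaving the interaction tensors of that step and
the systems in transit; each output `a i` is recorded along with the legs of party `i`. -/
def outgoing (t : Fin (τ + 1)) (a : ∀ i, A i t) (z : σ.InFlight (t + 1)) :
    (∀ i, A i t × ∀ j, σ.wire i j (t + G.latency i j)) × σ.Spectators t :=
  (fun i => (a i, fun j => z i j ⟨t + G.latency i j, by
      have := G.latency_pos i j; constructor <;> omega⟩),
    fun i j r => z i j ⟨r.1, r.2.1, by have := r.2.2; omega⟩)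

theorem outgoing_injective (t : Fin (τ + 1)) (a : ∀ i, A i t) :
    Function.Injective (σ.outgoing t a) := by
  intro z z' h
  funext i j ⟨r, hr⟩
  by_cases hr' : r = t + G.latency i j
  · subst hr'
    exact congrFun (congrArg Prod.snd (congrFun (congrArg Prod.fst h) i)) j
  · exact congrFun (congrFun (congrFun (congrArg Prod.snd h) i) j)
      ⟨r, hr.1, lt_of_le_of_ne (by have := hr.2; omega) hr'⟩

theorem registers_bijective :
    Function.Bijective fun (z : σ.InFlight 0) (i : Fin n) =>
      z i i ⟨0, le_refl 0, Nat.lt_add_of_pos_right (G.latency_pos i i)⟩ := by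
  constructor
  · intro z z' h
    funext i j ⟨r, hr⟩
    by_cases hij : i = j
    · subst hij
      have hr0 : r = 0 := by have := hr.2; rw [G.latency_self] at this; omega
      subst hr0
      exact congrFun h i
    · obtain ⟨hu⟩ := σ.wire_trivial i j r hij (Or.inl (by simpa using hr.2))
      exact (@Unique.instSubsingleton _ hu).elim _ _
  · intro x
    classical
    have hd : ∀ i j (r : ℕ), r < G.latency i j → i ≠ j → Nonempty (σ.wire i j r) := fun i j r h h' => by
      obtain ⟨hu⟩ := σ.wire_trivial i j r h' (Or.inl h)
      exact ⟨hu.default⟩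
    have key : ∀ i j (r : ℕ), r < G.latency i j →
        ∃ y : σ.wire i j r, ∀ (h : i = j) (h' : 0 = r), y = h' ▸ h ▸ x i := by
      intro i j r hr
      by_cases h : i = j
      · subst h
        have h0 : r = 0 := by rw [G.latency_self] at hr; omega
        subst h0
        exact ⟨x i, fun _ _ => rfl⟩
      · exact ⟨(hd i j r hr h).some, fun h' => absurd h' h⟩
    choose y hy using key
    refine ⟨fun i j r => y i j r.1 (by simpa using r.2.2), ?_⟩
    funext i
    exact hy i i 0 _ rfl rfl

/-- The initial state, as a vector of the systems before step `0` (all of them are trivial except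
for the initial registers). -/
def initialState : Ell2 (σ.InFlight 0) := pullback _ σ.registers_bijective.injective σ.state

/-- One time step: apply `⨂ᵢ ⟨aᵢ| W_i^{(t)} |sᵢ⟩` to the legs entering the interaction tensors and
the identity to the systems in transit. -/
def step (t : Fin (τ + 1)) (a : ∀ i, A i t) (s : ∀ i, S i t) (v : Ell2 (σ.InFlight t)) :
    Ell2 (σ.InFlight (t + 1)) :=
  pullback (σ.outgoing t a) (σ.outgoing_injective t a)
    (applyLeft (tensorIsometry fun i => σ.tensor i t (s i))
      (pullback (σ.incoming t) (σ.incoming_bijective t).injective v))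

/-- The unnormalized vector `|ψ(a|s)⟩ = ∏_{t=0}^{τ} [⨂ᵢ ⟨a_i^{(t)}| W_i^{(t)} |s_i^{(t)}⟩] |ψ⟩`, the
product being taken from right to left. -/
def finalState (a : ∀ i t, A i t) (s : ∀ i t, S i t) : Ell2 (σ.InFlight (τ + 1)) :=
  Fin.induction (motive := fun t : Fin (τ + 2) => Ell2 (σ.InFlight t)) σ.initialState
    (fun t v => σ.step t (fun i => a i t) (fun i => s i t) v) (Fin.last (τ + 1))

/-- The behavior `p(a|s) = ‖|ψ(a|s)⟩‖²` realized by a quantum strategy. -/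
def behavior (a : ∀ i t, A i t) (s : ∀ i t, S i t) : ℝ := ‖σ.finalState a s‖ ^ 2

end QuantumStrategy

/-- The set `𝒬` of all behaviors realized by quantum strategies. -/
def quantumBehaviors {n τ : ℕ} {S : Fin n → Fin (τ + 1) → Type v}
    {A : Fin n → Fin (τ + 1) → Type w} (G : LCGame n τ S A) :
    Set ((∀ i t, A i t) → (∀ i t, S i t) → ℝ) :=
  {p | ∃ σ : QuantumStrategy.{u} G, σ.behavior = p}

end

/-!
The set of quantum behaviors is convex because the parties can share randomness through their
initial registers. Given strategies `σ k` and amplitudes `c k` with `∑ ‖c k‖² = 1`, the mixture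
`QuantumStrategy.mix` starts in the superposition `∑ c k • |ψ_k⟩` of the initial states, placed in
mutually orthogonal sectors, and every interaction tensor acts on the `k`-th sector as the tensor of
the `k`-th strategy. Each party carries `k` on the wire to itself at all times, so it always knows
the sector although the one-dimensional legs carry no information.

The interaction tensors have to be isometries on the whole space of incoming legs, also where the
labels `k` of different legs disagree. Therefore the basis of a wire has further vectors
(`WireLabel.junk`), into which a party can move any combination of incoming basis vectors;
`exists_isometry_extending` then provides the tensors.

Writing sectors as images of extension by zero (`extendByZero`), a time step of the mixture commutes
with the inclusion of the `k`-th sector (`QuantumStrategy.mix_step`). Hence the final state of the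
mixture is the superposition of the final states of the strategies, in sectors that are orthogonal,
and the squared norm is the convex combination of the behaviors (`QuantumStrategy.mix_behavior`).
-/

noncomputable section

/-! ### Extension by zero -/

/-- The isometry `ℓ²(I) → ℓ²(J)` that maps the basis vector at `x` to the basis vector at `f x`, for
an injective `f`: coordinates outside the range of `f` are zero. -/
def extendByZero {I J : Type*} (f : I → J) (hf : Function.Injective f) : Ell2 I →ₗᵢ[ℂ] Ell2 J where
  toFun v := ⟨Function.extend f v 0, memEll2_iff.2 <| by
    rw [← hf.summable_iff fun y hy => by simp [Function.extend_apply' _ _ _ hy]]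
    simpa [Function.comp_def, hf.extend_apply] using (hasSum_normSq v).summable⟩
  map_add' v v' := by
    ext y
    change Function.extend f (v + v' : Ell2 I) 0 y =
      Function.extend f v 0 y + Function.extend f v' 0 y
    by_cases hy : ∃ x, f x = y
    · obtain ⟨x, rfl⟩ := hy
      rw [hf.extend_apply, hf.extend_apply, hf.extend_apply]
      rfl
    · rw [Function.extend_apply' _ _ _ hy, Function.extend_apply' _ _ _ hy,
        Function.extend_apply' _ _ _ hy]
      exact (add_zero 0).symm
  map_smul' c v := by
    ext y
    by_cases hy : ∃ x, f x = y
    · obtain ⟨x, rfl⟩ := hy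
      simp [hf.extend_apply]
    · simp [Function.extend_apply' _ _ _ hy]
  norm_map' v := by
    refine (sq_eq_sq₀ (norm_nonneg _) (norm_nonneg _)).1 ?_
    refine (hasSum_normSq _).unique ?_
    rw [← hf.hasSum_iff fun y hy => by simp [Function.extend_apply' _ _ _ hy]]
    simpa [Function.comp_def, hf.extend_apply] using hasSum_normSq v

section ExtendByZero

variable {I J : Type*} {f : I → J} (hf : Function.Injective f)

theorem extendByZero_apply (v : Ell2 I) (x : I) : extendByZero f hf v (f x) = v x :=
  hf.extend_apply _ _ _

theorem extendByZero_apply_of_notMem (v : Ell2 I) {y : J} (hy : ¬∃ x, f x = y) :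
    extendByZero f hf v y = 0 :=
  Function.extend_apply' _ _ _ hy

theorem basisVec_apply_self (x : I) : basisVec x x = (1 : ℂ) := by
  simp [basisVec]

theorem basisVec_apply_of_ne {x y : I} (h : y ≠ x) : basisVec x y = (0 : ℂ) := by
  classical
  simp [basisVec, h]

theorem extendByZero_basisVec (x : I) : extendByZero f hf (basisVec x) = basisVec (f x) := by
  ext y
  by_cases hy : ∃ x, f x = y
  · obtain ⟨x', rfl⟩ := hy
    rw [extendByZero_apply]
    by_cases h : x' = x
    · rw [h, basisVec_apply_self, basisVec_apply_self]
    · rw [basisVec_apply_of_ne h, basisVec_apply_of_ne (hf.ne h)]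
  · rw [extendByZero_apply_of_notMem hf _ hy, basisVec_apply_of_ne fun h => hy ⟨x, h.symm⟩]

/-- Isometries from `ℓ²(I)` are determined by their values on the standard basis. -/
theorem Ell2.isometry_ext {F : Type*} [NormedAddCommGroup F] [NormedSpace ℂ F]
    {U V : Ell2 I →ₗᵢ[ℂ] F} (h : ∀ x, U (basisVec x) = V (basisVec x)) : U = V := by
  classical
  have h' : U.toContinuousLinearMap = V.toContinuousLinearMap := by
    refine lp.ext_continuousLinearMap (by norm_num) fun x => ?_
    ext
    simpa [basisVec, Subsingleton.elim (Classical.decEq I) _] using h x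
  ext v
  exact DFunLike.congr_fun h' v

theorem linearIsometry_basisVec {F : Type*} [NormedAddCommGroup F] [InnerProductSpace ℂ F]
    [CompleteSpace F] {w : I → F} (hw : Orthonormal ℂ w) (x : I) :
    hw.orthogonalFamily.linearIsometry (basisVec x) = w x := by
  classical
  refine (OrthogonalFamily.linearIsometry_apply_single hw.orthogonalFamily (1 : ℂ)).trans ?_
  exact one_smul ℂ (w x)

theorem inner_extendByZero_of_disjoint {I' : Type*} {f' : I' → J} (hf' : Function.Injective f')
    (h : ∀ x x', f x ≠ f' x') (v : Ell2 I) (v' : Ell2 I') :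
    inner ℂ (extendByZero f hf v) (extendByZero f' hf' v') = 0 := by
  rw [lp.inner_eq_tsum]
  convert tsum_zero with y
  by_cases hy : ∃ x, f x = y
  · obtain ⟨x, rfl⟩ := hy
    rw [extendByZero_apply_of_notMem hf' v' fun ⟨x', hx'⟩ => h x x' hx'.symm, inner_zero_right]
  · rw [extendByZero_apply_of_notMem hf v hy, inner_zero_left]

/-- The subspaces of `ℓ²(J)` spanned by pairwise disjoint parts of the basis are orthogonal. -/
theorem orthogonalFamily_extendByZero {K : Type*} {I : K → Type*} {f : ∀ k, I k → J}
    (hf : ∀ k, Function.Injective (f k)) (hd : ∀ k k' x x', f k x = f k' x' → k = k') :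
    OrthogonalFamily ℂ (fun k => Ell2 (I k)) fun k => extendByZero (f k) (hf k) :=
  fun k k' hk => inner_extendByZero_of_disjoint (hf k) (hf k')
    fun x x' hx => hk (hd k k' x x' hx)

theorem norm_sq_sum_extendByZero {K : Type*} [Fintype K] {I : K → Type*} {f : ∀ k, I k → J}
    (hf : ∀ k, Function.Injective (f k)) (hd : ∀ k k' x x', f k x = f k' x' → k = k')
    (c : K → ℂ) (v : ∀ k, Ell2 (I k)) :
    ‖∑ k, c k • extendByZero (f k) (hf k) (v k)‖ ^ 2 = ∑ k, ‖c k‖ ^ 2 * ‖v k‖ ^ 2 := by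
  have h := (orthogonalFamily_extendByZero hf hd).norm_sum (fun k => c k • v k) Finset.univ
  simpa [norm_smul, mul_pow] using h

/-- Reading off coordinates commutes with extension by zero along a commutative square of index
maps, provided that the square is a pullback. -/
theorem pullback_extendByZero {X Y X' Y' : Type*} {q : Y' → Y} (hq : Function.Injective q)
    {p : X → Y} (hp : Function.Injective p) {q' : X' → X} (hq' : Function.Injective q')
    {p' : X' → Y'} (hp' : Function.Injective p') (comm : ∀ x, p (q' x) = q (p' x))
    (cart : ∀ z y, p z = q y → ∃ x, q' x = z) (v : Ell2 Y') :
    pullback p hp (extendByZero q hq v) = extendByZero q' hq' (pullback p' hp' v) := by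
  ext z
  change extendByZero q hq v (p z) = _
  by_cases hz : ∃ x, q' x = z
  · obtain ⟨x, rfl⟩ := hz
    rw [comm, extendByZero_apply, extendByZero_apply]
    rfl
  · rw [extendByZero_apply_of_notMem hq' _ hz,
      extendByZero_apply_of_notMem hq _ fun ⟨y, hy⟩ => hz (cart z y hy.symm)]

end ExtendByZero

/-! ### Isometries that restrict to given isometries -/

/-- Given isometries `U k` between subspaces of `ℓ²(I)` and `ℓ²(J)` that are spanned by disjoint
parts of the standard bases, there is an isometry `ℓ²(I) → ℓ²(J)` that extends all of them, provided
that the basis of `ℓ²(I)` can be embedded in the unused part of the basis of `ℓ²(J)`. -/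
theorem exists_isometry_extending {K : Type*} {I' J' : K → Type*} {I J : Type*}
    (f : ∀ k, I' k → I) (g : ∀ k, J' k → J) (h : I → J)
    (hf : ∀ k, Function.Injective (f k)) (hfd : ∀ k k' x x', f k x = f k' x' → k = k')
    (hg : ∀ k, Function.Injective (g k)) (hgd : ∀ k k' y y', g k y = g k' y' → k = k')
    (hh : Function.Injective h) (hgh : ∀ k y x, g k y ≠ h x)
    (U : ∀ k, Ell2 (I' k) →ₗᵢ[ℂ] Ell2 (J' k)) :
    ∃ V : Ell2 I →ₗᵢ[ℂ] Ell2 J,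
      ∀ k v, V (extendByZero (f k) (hf k) v) = extendByZero (g k) (hg k) (U k v) := by
  classical
  -- The images `w y` of the basis vectors: prescribed by `U k` on the range of `f k`, and the unused
  -- basis vector `h y` elsewhere.
  have key : ∀ y : I, ∃ w : Ell2 J,
      (∀ k x, f k x = y → w = extendByZero (g k) (hg k) (U k (basisVec x))) ∧
      ((¬∃ k x, f k x = y) → w = basisVec (h y)) := by
    intro y
    by_cases hy : ∃ k x, f k x = y
    · obtain ⟨k, x, rfl⟩ := hy
      refine ⟨extendByZero (g k) (hg k) (U k (basisVec x)), fun k' x' hx => ?_,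
        fun hn => absurd ⟨k, x, rfl⟩ hn⟩
      obtain rfl := hfd _ _ _ _ hx
      rw [hf _ hx]
    · exact ⟨basisVec (h y), fun k x hx => absurd ⟨k, x, hx⟩ hy, fun _ => rfl⟩
  choose w hw hw' using key
  have hgw : ∀ k v y, inner ℂ (extendByZero (g k) (hg k) v) (basisVec (h y)) = 0 := by
    intro k v y
    have := inner_extendByZero_of_disjoint (hg k) hh (hgh k) v (basisVec y)
    rwa [extendByZero_basisVec] at this
  have horth : Orthonormal ℂ w := by
    constructor
    · intro y
      by_cases hy : ∃ k x, f k x = y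
      · obtain ⟨k, x, hx⟩ := hy
        rw [hw y k x hx, LinearIsometry.norm_map, LinearIsometry.norm_map]
        exact basisVec_orthonormal.1 x
      · rw [hw' y hy]
        exact basisVec_orthonormal.1 _
    · intro y y' hne
      by_cases hy : ∃ k x, f k x = y <;> by_cases hy' : ∃ k x, f k x = y'
      · obtain ⟨k, x, rfl⟩ := hy
        obtain ⟨k', x', rfl⟩ := hy'
        rw [hw _ k x rfl, hw _ k' x' rfl]
        by_cases hk : k = k'
        · subst hk
          rw [LinearIsometry.inner_map_map, LinearIsometry.inner_map_map]
          exact basisVec_orthonormal.2 fun hx => hne (by rw [hx])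
        · exact inner_extendByZero_of_disjoint (hg k) (hg k')
            (fun z z' hz => hk (hgd _ _ _ _ hz)) _ _
      · obtain ⟨k, x, hx⟩ := hy
        rw [hw y k x hx, hw' y' hy']
        exact hgw _ _ _
      · obtain ⟨k, x, hx⟩ := hy'
        rw [hw y' k x hx, hw' y hy, inner_eq_zero_symm]
        exact hgw _ _ _
      · rw [hw' y hy, hw' y' hy']
        exact basisVec_orthonormal.2 (hh.ne hne)
  have hV := linearIsometry_basisVec horth
  refine ⟨horth.orthogonalFamily.linearIsometry, fun k v => ?_⟩
  refine DFunLike.congr_fun (Ell2.isometry_ext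
    (U := horth.orthogonalFamily.linearIsometry.comp (extendByZero (f k) (hf k)))
    (V := (extendByZero (g k) (hg k)).comp (U k)) fun x => ?_) v
  change horth.orthogonalFamily.linearIsometry (extendByZero (f k) (hf k) (basisVec x)) =
    extendByZero (g k) (hg k) (U k (basisVec x))
  rw [extendByZero_basisVec, hV, hw _ k x rfl]

/-! ### Tensor products and extension by zero -/

theorem injective_piMap {n : ℕ} {I J : Fin n → Type*} {f : ∀ i, I i → J i}
    (hf : ∀ i, Function.Injective (f i)) :
    Function.Injective fun (x : ∀ i, I i) i => f i (x i) :=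
  fun _ _ h => funext fun i => hf i (congrFun h i)

theorem tensorVec_extendByZero {n : ℕ} {I J : Fin n → Type*} {f : ∀ i, I i → J i}
    (hf : ∀ i, Function.Injective (f i)) (v : ∀ i, Ell2 (I i)) :
    tensorVec (fun i => extendByZero (f i) (hf i) (v i)) =
      extendByZero (fun (x : ∀ i, I i) i => f i (x i)) (injective_piMap hf) (tensorVec v) := by
  ext y
  change ∏ i, extendByZero (f i) (hf i) (v i) (y i) = _
  by_cases hy : ∃ x : ∀ i, I i, (fun i => f i (x i)) = y
  · obtain ⟨x, rfl⟩ := hy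
    have h := extendByZero_apply (injective_piMap hf) (tensorVec v) x
    rw [h]
    exact Finset.prod_congr rfl fun i _ => extendByZero_apply (hf i) (v i) (x i)
  · rw [extendByZero_apply_of_notMem (injective_piMap hf) _ hy]
    have : ∃ i, ¬∃ x, f i x = y i := by
      by_contra! hc
      choose x hx using hc
      exact hy ⟨x, funext hx⟩
    obtain ⟨i, hi⟩ := this
    exact Finset.prod_eq_zero (Finset.mem_univ i) (extendByZero_apply_of_notMem (hf i) _ hi)

theorem tensorIsometry_basisVec {n : ℕ} {I J : Fin n → Type*}
    (W : ∀ i, Ell2 (I i) →ₗᵢ[ℂ] Ell2 (J i)) (x : ∀ i, I i) :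
    tensorIsometry W (basisVec x) = tensorVec fun i => W i (basisVec (x i)) :=
  linearIsometry_basisVec (tensorVec_orthonormal W) x

theorem tensorIsometry_extendByZero {n : ℕ} {I J I' J' : Fin n → Type*}
    {W : ∀ i, Ell2 (I i) →ₗᵢ[ℂ] Ell2 (J i)} {W' : ∀ i, Ell2 (I' i) →ₗᵢ[ℂ] Ell2 (J' i)}
    {f : ∀ i, I' i → I i} (hf : ∀ i, Function.Injective (f i))
    {g : ∀ i, J' i → J i} (hg : ∀ i, Function.Injective (g i))
    (h : ∀ i v, W i (extendByZero (f i) (hf i) v) = extendByZero (g i) (hg i) (W' i v))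
    (v : Ell2 (∀ i, I' i)) :
    tensorIsometry W (extendByZero (fun x i => f i (x i)) (injective_piMap hf) v) =
      extendByZero (fun x i => g i (x i)) (injective_piMap hg) (tensorIsometry W' v) := by
  refine DFunLike.congr_fun (Ell2.isometry_ext
    (U := (tensorIsometry W).comp (extendByZero (fun x i => f i (x i)) (injective_piMap hf)))
    (V := (extendByZero (fun x i => g i (x i)) (injective_piMap hg)).comp (tensorIsometry W'))
    fun x => ?_) v
  change tensorIsometry W (extendByZero _ (injective_piMap hf) (basisVec x)) =
    extendByZero _ (injective_piMap hg) (tensorIsometry W' (basisVec x))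
  rw [extendByZero_basisVec, tensorIsometry_basisVec, tensorIsometry_basisVec,
    ← tensorVec_extendByZero hg]
  congr 1
  funext i
  rw [← h, extendByZero_basisVec]

theorem applyLeft_extendByZero {I J R I' J' R' : Type*}
    {U : Ell2 I →ₗᵢ[ℂ] Ell2 J} {U' : Ell2 I' →ₗᵢ[ℂ] Ell2 J'}
    {f : I' → I} (hf : Function.Injective f) {g : J' → J} (hg : Function.Injective g)
    {q : R' → R} (hq : Function.Injective q)
    (h : ∀ v, U (extendByZero f hf v) = extendByZero g hg (U' v)) (v : Ell2 (I' × R')) :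
    applyLeft U (extendByZero (Prod.map f q) (hf.prodMap hq) v) =
      extendByZero (Prod.map g q) (hg.prodMap hq) (applyLeft U' v) := by
  ext ⟨y, r⟩
  change U (slice _ r) y = _
  by_cases hr : ∃ r', q r' = r
  · obtain ⟨r', rfl⟩ := hr
    have hs : slice (extendByZero (Prod.map f q) (hf.prodMap hq) v) (q r') =
        extendByZero f hf (slice v r') :=
      pullback_extendByZero (hf.prodMap hq) (Prod.mk_left_injective (q r')) hf
        (Prod.mk_left_injective r') (fun _ => rfl)
        (fun z y hy => ⟨y.1, (congrArg Prod.fst hy).symm⟩) v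
    have hs' : slice (extendByZero (Prod.map g q) (hg.prodMap hq) (applyLeft U' v)) (q r') =
        extendByZero g hg (slice (applyLeft U' v) r') :=
      pullback_extendByZero (hg.prodMap hq) (Prod.mk_left_injective (q r')) hg
        (Prod.mk_left_injective r') (fun _ => rfl)
        (fun z y hy => ⟨y.1, (congrArg Prod.fst hy).symm⟩) (applyLeft U' v)
    rw [hs, h]
    exact (congrArg (fun u : Ell2 J => u y) hs').symm
  · have hs : slice (extendByZero (Prod.map f q) (hf.prodMap hq) v) r = 0 := by
      ext x
      exact extendByZero_apply_of_notMem (hf.prodMap hq) v fun ⟨z, hz⟩ =>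
        hr ⟨z.2, congrArg Prod.snd hz⟩
    rw [hs, map_zero,
      extendByZero_apply_of_notMem _ _ fun ⟨z, hz⟩ => hr ⟨z.2, congrArg Prod.snd hz⟩]
    rfl

/-! ### Linearity of a time step -/

/-- `pullback` as a linear map. -/
def pullbackLinear {I J : Type*} (f : I → J) (hf : Function.Injective f) :
    Ell2 J →ₗ[ℂ] Ell2 I where
  toFun := pullback f hf
  map_add' _ _ := rfl
  map_smul' _ _ := rfl

/-- `applyLeft` as a linear map of the vector. -/
def applyLeftLinear {I J R : Type*} (U : Ell2 I →ₗᵢ[ℂ] Ell2 J) :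
    Ell2 (I × R) →ₗ[ℂ] Ell2 (J × R) where
  toFun := applyLeft U
  map_add' v v' := lp.ext <| funext fun z =>
    congrArg (fun u : Ell2 J => u z.1) (map_add U (slice v z.2) (slice v' z.2))
  map_smul' c v := lp.ext <| funext fun z =>
    congrArg (fun u : Ell2 J => u z.1) (map_smul U c (slice v z.2))

theorem map_sum_smul {K E F : Type*} [Fintype K] [AddCommMonoid E] [AddCommMonoid F] [Module ℂ E]
    [Module ℂ F] (L : E →ₗ[ℂ] F) (c : K → ℂ) (v : K → E) :
    L (∑ k, c k • v k) = ∑ k, c k • L (v k) := by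
  simp

namespace QuantumStrategy

section StepLinear

variable {n τ : ℕ} {S : Fin n → Fin (τ + 1) → Type v} {A : Fin n → Fin (τ + 1) → Type w}
  {G : LCGame n τ S A} (σ : QuantumStrategy.{u} G)

/-- `step` as a linear map of the state. -/
def stepLinear (t : Fin (τ + 1)) (a : ∀ i, A i t) (s : ∀ i, S i t) :
    Ell2 (σ.InFlight t) →ₗ[ℂ] Ell2 (σ.InFlight (t + 1)) :=
  pullbackLinear _ (σ.outgoing_injective t a) ∘ₗ
    applyLeftLinear (tensorIsometry fun i => σ.tensor i t (s i)) ∘ₗ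
    pullbackLinear _ (σ.incoming_bijective t).injective

theorem step_sum_smul {K : Type*} [Fintype K] (t : Fin (τ + 1)) (a : ∀ i, A i t) (s : ∀ i, S i t)
    (c : K → ℂ) (v : K → Ell2 (σ.InFlight t)) :
    σ.step t a s (∑ k, c k • v k) = ∑ k, c k • σ.step t a s (v k) :=
  map_sum_smul (σ.stepLinear t a s) c v

end StepLinear

end QuantumStrategy

/-! ### The basis of a mixture of strategies -/

/-- Labels for the basis vectors of the wires of a mixture: the basis vectors `T` of the wires of
the original strategies, a label `vacant` for the wires that carry nothing, and one further label
`junk x` for each `n`-tuple `x` of labels.  The latter leave room to store an arbitrary combination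
of incoming labels. -/
inductive WireLabel (n : ℕ) (T : Type u) : Type u
  | vacant : WireLabel n T
  | wire : T → WireLabel n T
  | junk : (Fin n → WireLabel n T) → WireLabel n T

/-- The legs that a strategy is required to have one-dimensional. -/
def LCGame.TrivialLeg {n τ : ℕ} {S : Fin n → Fin (τ + 1) → Type v}
    {A : Fin n → Fin (τ + 1) → Type w} (G : LCGame n τ S A) (i j : Fin n) (r : ℕ) : Prop :=
  i ≠ j ∧ (r < G.latency i j ∨ τ < r)

namespace QuantumStrategy

variable {n τ : ℕ} {S : Fin n → Fin (τ + 1) → Type v} {A : Fin n → Fin (τ + 1) → Type w}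
  {G : LCGame n τ S A} {K : Type} (σ : K → QuantumStrategy.{u} G)

/-- The basis vectors of all wires of all strategies of the family. -/
abbrev AllWires : Type u := Σ (k : K) (i j : Fin n) (r : ℕ), (σ k).wire i j r

/-- The basis of a wire of the mixture: all labels, or only `vacant` if the leg has to be
one-dimensional. -/
abbrev MixWire (i j : Fin n) (r : ℕ) : Type u :=
  {x : WireLabel n (AllWires σ) // G.TrivialLeg i j r → x = .vacant}

open scoped Classical in
/-- The wires of the `k`-th strategy inside the wires of the mixture. -/
def toMixWire (k : K) (i j : Fin n) (r : ℕ) (x : (σ k).wire i j r) : MixWire σ i j r :=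
  ⟨if G.TrivialLeg i j r then .vacant else .wire ⟨k, i, j, r, x⟩, fun h => if_pos h⟩

theorem toMixWire_injective (k : K) (i j : Fin n) (r : ℕ) :
    Function.Injective (toMixWire σ k i j r) := by
  intro x x' h
  by_cases ht : G.TrivialLeg i j r
  · obtain ⟨hu⟩ := (σ k).wire_trivial i j r ht.1 ht.2
    exact (@Unique.instSubsingleton _ hu).elim _ _
  · simpa [toMixWire, ht] using h

/-- The label of the strategy can be read off from the wire of a party to itself. -/
theorem eq_of_toMixWire_self {k k' : K} {i : Fin n} {r : ℕ} {x : (σ k).wire i i r}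
    {x' : (σ k').wire i i r} (h : toMixWire σ k i i r x = toMixWire σ k' i i r x') : k = k' := by
  have ht : ¬G.TrivialLeg i i r := fun h => h.1 rfl
  have h' := congrArg Subtype.val h
  simp only [toMixWire, ht, if_false, WireLabel.wire.injEq, Sigma.mk.injEq] at h'
  exact h'.1

/-- The systems in flight in the `k`-th strategy inside those of the mixture. -/
def toMixInFlight (k : K) (t : ℕ) (z : (σ k).InFlight t) :
    ∀ i j, ∀ r : Set.Ico t (t + G.latency i j), MixWire σ i j r :=
  fun i j r => toMixWire σ k i j r (z i j r)

theorem toMixInFlight_injective (k : K) (t : ℕ) : Function.Injective (toMixInFlight σ k t) :=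
  fun _ _ h => funext fun i => funext fun j => funext fun r =>
    toMixWire_injective σ k i j r (congrFun (congrFun (congrFun h i) j) r)

theorem eq_of_toMixInFlight {k k' : K} {t : ℕ} {z : (σ k).InFlight t} {z' : (σ k').InFlight t}
    (h : toMixInFlight σ k t z = toMixInFlight σ k' t z') : k = k' := by
  have i : Fin n := ⟨0, by have := G.two_le; omega⟩
  exact eq_of_toMixWire_self σ (congrFun (congrFun (congrFun h i) i)
    ⟨t, le_refl t, Nat.lt_add_of_pos_right (G.latency_pos i i)⟩)

theorem toMixRegisters_injective (k : K) :
    Function.Injective fun (x : ∀ i, (σ k).wire i i 0) i => toMixWire σ k i i 0 (x i) :=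
  injective_piMap fun i => toMixWire_injective σ k i i 0

theorem eq_of_toMixRegisters {k k' : K} {x : ∀ i, (σ k).wire i i 0} {x' : ∀ i, (σ k').wire i i 0}
    (h : (fun i => toMixWire σ k i i 0 (x i)) = fun i => toMixWire σ k' i i 0 (x' i)) : k = k' :=
  eq_of_toMixWire_self σ (congrFun h ⟨0, by have := G.two_le; omega⟩)

/-! ### The interaction tensors of a mixture -/

/-- The legs entering an interaction tensor. -/
def toMixIn (k : K) (i : Fin n) (t : ℕ) (x : ∀ j, (σ k).wire j i t) (j : Fin n) :
    MixWire σ j i t :=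
  toMixWire σ k j i t (x j)

/-- The legs leaving an interaction tensor, along with the classical output. -/
def toMixOut (k : K) (i : Fin n) (t : Fin (τ + 1))
    (y : A i t × ∀ j, (σ k).wire i j (t + G.latency i j)) :
    A i t × ∀ j, MixWire σ i j (t + G.latency i j) :=
  (y.1, fun j => toMixWire σ k i j _ (y.2 j))

theorem toMixIn_injective (k : K) (i : Fin n) (t : ℕ) : Function.Injective (toMixIn σ k i t) :=
  injective_piMap fun j => toMixWire_injective σ k j i t

theorem toMixOut_injective (k : K) (i : Fin n) (t : Fin (τ + 1)) :
    Function.Injective (toMixOut σ k i t) :=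
  Function.injective_id.prodMap (injective_piMap fun j => toMixWire_injective σ k i j _)

open scoped Classical in
/-- An embedding of all combinations of incoming labels of a party: the combination is stored as a
junk label on the wire of the party to itself. -/
def storeJunk (i : Fin n) (t : Fin (τ + 1)) (a : A i t) (y : ∀ j, MixWire σ j i t) :
    A i t × ∀ j, MixWire σ i j (t + G.latency i j) :=
  (a, fun j => ⟨if i = j then .junk fun j => (y j).1 else .vacant, fun h => if_neg h.1⟩)

theorem storeJunk_injective (i : Fin n) (t : Fin (τ + 1)) (a : A i t) :
    Function.Injective (storeJunk σ i t a) := by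
  intro y y' h
  have h' := congrArg Subtype.val (congrFun (congrArg Prod.snd h) i)
  simp only [storeJunk, if_true, WireLabel.junk.injEq] at h'
  exact funext fun j => Subtype.ext (congrFun h' j)

theorem toMixOut_ne_storeJunk (k : K) (i : Fin n) (t : Fin (τ + 1)) (a : A i t)
    (y : A i t × ∀ j, (σ k).wire i j (t + G.latency i j)) (x : ∀ j, MixWire σ j i t) :
    toMixOut σ k i t y ≠ storeJunk σ i t a x := by
  intro h
  have ht : ¬G.TrivialLeg i i (t + G.latency i i) := fun h => h.1 rfl
  have h' := congrArg Subtype.val (congrFun (congrArg Prod.snd h) i)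
  simp [storeJunk, toMixOut, toMixWire, ht] at h'

theorem exists_mixTensor [∀ i t, Nonempty (A i t)] (i : Fin n) (t : Fin (τ + 1)) (s : S i t) :
    ∃ V : Ell2 (∀ j, MixWire σ j i t) →ₗᵢ[ℂ] Ell2 (A i t × ∀ j, MixWire σ i j (t + G.latency i j)),
      ∀ k v, V (extendByZero (toMixIn σ k i t) (toMixIn_injective σ k i t) v) =
        extendByZero (toMixOut σ k i t) (toMixOut_injective σ k i t) ((σ k).tensor i t s v) :=
  exists_isometry_extending (fun k => toMixIn σ k i t) (fun k => toMixOut σ k i t)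
    (storeJunk σ i t (Classical.arbitrary _)) (fun k => toMixIn_injective σ k i t)
    (fun _ _ _ _ h => eq_of_toMixWire_self σ (congrFun h i))
    (fun k => toMixOut_injective σ k i t)
    (fun _ _ _ _ h => eq_of_toMixWire_self σ (congrFun (congrArg Prod.snd h) i))
    (storeJunk_injective σ i t _) (fun k => toMixOut_ne_storeJunk σ k i t _)
    fun k => (σ k).tensor i t s

variable [Fintype K] [∀ i t, Nonempty (A i t)] (c : K → ℂ) (hc : ∑ k, ‖c k‖ ^ 2 = 1)

/-- The superposition of the strategies `σ k` with amplitudes `c k`.  On the span of the wire basis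
vectors of the `k`-th strategy, the interaction tensors are those of the `k`-th strategy. -/
def mix : QuantumStrategy.{u} G where
  wire := MixWire σ
  wire_trivial i j r h h' := ⟨⟨⟨⟨.vacant, fun _ => rfl⟩⟩, fun x => Subtype.ext (x.2 ⟨h, h'⟩)⟩⟩
  state := ∑ k, c k • extendByZero _ (toMixRegisters_injective σ k) (σ k).state
  norm_state := by
    refine (sq_eq_sq₀ (norm_nonneg _) zero_le_one).1 ?_
    refine (norm_sq_sum_extendByZero (toMixRegisters_injective σ)
      (fun _ _ _ _ h => eq_of_toMixRegisters σ h) c _).trans ?_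
    simp [(σ _).norm_state, hc]
  tensor i t s := (exists_mixTensor σ i t s).choose

theorem mix_tensor_extendByZero (k : K) (i : Fin n) (t : Fin (τ + 1)) (s : S i t)
    (v : Ell2 (∀ j, (σ k).wire j i t)) :
    (mix σ c hc).tensor i t s (extendByZero (toMixIn σ k i t) (toMixIn_injective σ k i t) v) =
      extendByZero (toMixOut σ k i t) (toMixOut_injective σ k i t) ((σ k).tensor i t s v) :=
  (exists_mixTensor σ i t s).choose_spec k v

/-! ### The evolution of a mixture -/

/-- The systems in transit in the `k`-th strategy inside those of the mixture. -/
def toMixSpectators (k : K) (t : ℕ) (z : (σ k).Spectators t) : (mix σ c hc).Spectators t :=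
  fun i j r => toMixWire σ k i j r (z i j r)

theorem toMixSpectators_injective (k : K) (t : ℕ) :
    Function.Injective (toMixSpectators σ c hc k t) :=
  fun _ _ h => funext fun i => funext fun j => funext fun r =>
    toMixWire_injective σ k i j r (congrFun (congrFun (congrFun h i) j) r)

theorem mix_initialState : (mix σ c hc).initialState =
    ∑ k, c k • extendByZero (toMixInFlight σ k 0) (toMixInFlight_injective σ k 0)
      (σ k).initialState := by
  have h : ∀ k, pullback _ (mix σ c hc).registers_bijective.injective
      (extendByZero _ (toMixRegisters_injective σ k) (σ k).state) =
      extendByZero (toMixInFlight σ k 0) (toMixInFlight_injective σ k 0) (σ k).initialState := by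
    intro k
    refine pullback_extendByZero (toMixRegisters_injective σ k)
      (mix σ c hc).registers_bijective.injective (toMixInFlight_injective σ k 0)
      (σ k).registers_bijective.injective (fun _ => rfl) (fun z y hy => ?_) _
    obtain ⟨z', rfl⟩ := (σ k).registers_bijective.surjective y
    exact ⟨z', (mix σ c hc).registers_bijective.injective hy.symm⟩
  exact (map_sum_smul (pullbackLinear _ (mix σ c hc).registers_bijective.injective) c _).trans
    (Finset.sum_congr rfl fun k _ => congrArg (c k • ·) (h k))

/-- On the systems of the `k`-th strategy, a step of the mixture is a step of that strategy. -/
theorem mix_step (k : K) (t : Fin (τ + 1)) (a : ∀ i, A i t) (s : ∀ i, S i t)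
    (v : Ell2 ((σ k).InFlight t)) :
    (mix σ c hc).step t a s
        (extendByZero (toMixInFlight σ k t) (toMixInFlight_injective σ k t) v) =
      extendByZero (toMixInFlight σ k (t + 1)) (toMixInFlight_injective σ k (t + 1))
        ((σ k).step t a s v) := by
  have hin : ∀ j : Fin n, Function.Injective (toMixIn σ k j t) := fun j => toMixIn_injective σ k j t
  have hout : ∀ j : Fin n, Function.Injective (toMixOut σ k j t) :=
    fun j => toMixOut_injective σ k j t
  have hsp := toMixSpectators_injective σ c hc k t
  have comm : ∀ z, (mix σ c hc).incoming t (Prod.map (fun x j => toMixIn σ k j t (x j))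
      (toMixSpectators σ c hc k t) z) = toMixInFlight σ k t ((σ k).incoming t z) := by
    intro z
    funext i j ⟨r, hr⟩
    by_cases h : (t : ℕ) = r
    · subst h
      simp [incoming, toMixInFlight]
      rfl
    · simp [incoming, toMixInFlight, h]
      rfl
  have h1 : pullback ((mix σ c hc).incoming t) ((mix σ c hc).incoming_bijective t).injective
      (extendByZero (toMixInFlight σ k t) (toMixInFlight_injective σ k t) v) =
      extendByZero _ ((injective_piMap hin).prodMap hsp)
        (pullback ((σ k).incoming t) ((σ k).incoming_bijective t).injective v) := by
    refine pullback_extendByZero _ _ _ _ comm (fun z y hy => ?_) _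
    obtain ⟨z', rfl⟩ := ((σ k).incoming_bijective t).surjective y
    exact ⟨z', ((mix σ c hc).incoming_bijective t).injective ((comm z').trans hy.symm)⟩
  have h2 := applyLeft_extendByZero (injective_piMap hin) (injective_piMap hout) hsp
    (tensorIsometry_extendByZero hin hout
      fun i v => mix_tensor_extendByZero σ c hc k i t (s i) v)
    (pullback ((σ k).incoming t) ((σ k).incoming_bijective t).injective v)
  refine (congrArg (fun u => pullback ((mix σ c hc).outgoing t a)
    ((mix σ c hc).outgoing_injective t a) (applyLeft _ u)) h1).trans ?_
  refine (congrArg (pullback ((mix σ c hc).outgoing t a)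
    ((mix σ c hc).outgoing_injective t a)) h2).trans ?_
  refine pullback_extendByZero ((injective_piMap hout).prodMap hsp)
    ((mix σ c hc).outgoing_injective t a) (toMixInFlight_injective σ k (t + 1))
    ((σ k).outgoing_injective t a) (fun _ => rfl) (fun z y hy => ?_)
    (applyLeft (tensorIsometry fun i => (σ k).tensor i t (s i))
      (pullback ((σ k).incoming t) ((σ k).incoming_bijective t).injective v))
  -- Every system in flight after the step is an outgoing leg or a spectator, so a basis vector
  -- lies in the `k`-th sector as soon as its legs and spectators do.
  have hz : ∀ i j (r : Set.Ico ((t : ℕ) + 1) (t + 1 + G.latency i j)),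
      ∃ x, toMixWire σ k i j r x = z i j r := by
    rintro i j ⟨r, hr⟩
    by_cases h : r = t + G.latency i j
    · subst h
      exact ⟨_, (congrFun (congrArg Prod.snd (congrFun (congrArg Prod.fst hy) i)) j).symm⟩
    · exact ⟨_, (congrFun (congrFun (congrFun (congrArg Prod.snd hy) i) j)
        ⟨r, hr.1, lt_of_le_of_ne (by have := hr.2; omega) h⟩).symm⟩
  choose x hx using hz
  exact ⟨x, funext fun i => funext fun j => funext fun r => hx i j r⟩

theorem mix_finalState (a : ∀ i t, A i t) (s : ∀ i t, S i t) :
    (mix σ c hc).finalState a s =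
      ∑ k, c k • extendByZero (toMixInFlight σ k (τ + 1)) (toMixInFlight_injective σ k (τ + 1))
        ((σ k).finalState a s) := by
  have key : ∀ t : Fin (τ + 2),
      Fin.induction (motive := fun t : Fin (τ + 2) => Ell2 ((mix σ c hc).InFlight t))
        (mix σ c hc).initialState
        (fun t v => (mix σ c hc).step t (fun i => a i t) (fun i => s i t) v) t =
      ∑ k, c k • extendByZero (toMixInFlight σ k t) (toMixInFlight_injective σ k t)
        (Fin.induction (motive := fun t : Fin (τ + 2) => Ell2 ((σ k).InFlight t))
          (σ k).initialState (fun t v => (σ k).step t (fun i => a i t) (fun i => s i t) v) t) := by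
    intro t
    induction t using Fin.induction with
    | zero => exact mix_initialState σ c hc
    | succ t ih =>
      refine (congrArg ((mix σ c hc).step t (fun i => a i t) (fun i => s i t)) ih).trans ?_
      refine (step_sum_smul (mix σ c hc) t (fun i => a i t) (fun i => s i t) c _).trans ?_
      exact Finset.sum_congr rfl fun k _ => congrArg (c k • ·)
        (mix_step σ c hc k t (fun i => a i t) (fun i => s i t) _)
  exact key (Fin.last (τ + 1))

/-- The branches of a mixture do not interfere, because the registers left with the parties tell
them apart. -/
theorem mix_behavior (a : ∀ i t, A i t) (s : ∀ i t, S i t) :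
    (mix σ c hc).behavior a s = ∑ k, ‖c k‖ ^ 2 * (σ k).behavior a s := by
  rw [behavior, mix_finalState]
  exact norm_sq_sum_extendByZero (fun k => toMixInFlight_injective σ k (τ + 1))
    (fun _ _ _ _ h => eq_of_toMixInFlight σ h) c _

end QuantumStrategy

end

/-- For every `τ`-step latency-constrained game, the set of quantum behaviors is convex. -/
theorem mainTheorem12 {n τ : ℕ}
    {S : Fin n → Fin (τ + 1) → Type v} {A : Fin n → Fin (τ + 1) → Type w}
    [∀ i t, Finite (S i t)] [∀ i t, Finite (A i t)]
    (G : LCGame n τ S A) :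
    Convex ℝ (quantumBehaviors.{u} G) := by
  rintro _ ⟨σ₀, rfl⟩ _ ⟨σ₁, rfl⟩ p q hp hq hpq
  by_cases hA : ∀ i t, Nonempty (A i t)
  · let σ : Bool → QuantumStrategy.{u} G := fun k => cond k σ₁ σ₀
    let c : Bool → ℂ := fun k => cond k (Real.sqrt q) (Real.sqrt p)
    have h0 : ‖c false‖ ^ 2 = p := by simp [c, Real.sq_sqrt hp]
    have h1 : ‖c true‖ ^ 2 = q := by simp [c, Real.sq_sqrt hq]
    refine ⟨QuantumStrategy.mix σ c (by rw [Fintype.sum_bool, h0, h1, add_comm, hpq]), ?_⟩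
    funext a s
    rw [QuantumStrategy.mix_behavior, Fintype.sum_bool, h0, h1, add_comm]
    rfl
  · -- With an empty output alphabet there are no outcomes, and all behaviors are equal.
    push Not at hA
    obtain ⟨i, t, h⟩ := hA
    exact ⟨σ₀, funext fun a => h.elim (a i t)⟩
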